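/- Let $T\subset\mathbb{R}^2$ be a (nondegenerate, closed) triangle with area $|T|$, and let $F$ be one of its edges, with length $|F|$. For an integer $k\ge 0$ let $\mathbb{P}_k(T)$ be the space of real polynomials in two variables of total degree at most $k$, regarded as functions on $T$, and let $\Pi_T^k$ be the $L^2(T)$-orthogonal projection onto $\mathbb{P}_k(T)$; put $\Pi_T^{-1}:=0$. Let $p\ge 0$ and $n$ be integers with $-1\le n\le p$. Then for every $\xi\in\mathbb{P}_p(T)$ the polynomial $\theta:=\xi-\Pi_T^n\xi$ satisfies $$\|\theta\|_{L^2(F)}^2\le\frac{(p-n)(p+n+3)}{2}\,\frac{|F|}{|T|}\,\|\theta\|_{L^2(T)}^2,$$ where $L^2(F)$ is taken with respect to arc length on $F$ and $L^2(T)$ with respect to area on $T$. -/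

import Mathlib

open MeasureTheory

noncomputable section

namespace InverseTrace

/-- The Euclidean plane. -/
abbrev Plane : Type := EuclideanSpace ℝ (Fin 2)

/-- Real polynomials in two variables. -/
abbrev Poly : Type := MvPolynomial (Fin 2) ℝ

/-- The value of a polynomial at a point of the plane. -/
def value (q : Poly) (x : Plane) : ℝ := MvPolynomial.eval x.ofLp q

/-- The polynomials of total degree at most `p`. -/
abbrev polySpace (p : ℕ) : Submodule ℝ Poly := MvPolynomial.restrictTotalDegree (Fin 2) ℝ p

/-- The closed region bounded by a nondegenerate triangle. -/
def region (T : Affine.Triangle ℝ Plane) : Set Plane := convexHull ℝ (Set.range T.points)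

/-- The edge of `T` joining the vertices with the labels `i` and `j`. -/
def edge (T : Affine.Triangle ℝ Plane) (i j : Fin 3) : Set Plane :=
  segment ℝ (T.points i) (T.points j)

/-- The arc length measure in the plane. -/
def lengthMeasure : Measure Plane := Measure.hausdorffMeasure 1

/-- The squared `L²` norm of `q` on the triangle, for the area measure. -/
def normSqTriangle (T : Affine.Triangle ℝ Plane) (q : Poly) : ℝ :=
  ∫ x in region T, value q x ^ 2

/-- The squared `L²` norm of `q` on an edge, for the arc length measure. -/
def normSqEdge (T : Affine.Triangle ℝ Plane) (i j : Fin 3) (q : Poly) : ℝ :=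
  ∫ x in edge T i j, value q x ^ 2 ∂lengthMeasure

/-- `r` is the `L²(T)`-orthogonal projection of `ξ` onto the polynomials of degree at most `n`. -/
structure IsL2Projection (T : Affine.Triangle ℝ Plane) (n : ℕ) (ξ r : Poly) : Prop where
  mem : r ∈ polySpace n
  orthogonal : ∀ q ∈ polySpace n, ∫ x in region T, value (ξ - r) x * value q x = 0

theorem continuous_value (q : Poly) : Continuous (value q) :=
  (MvPolynomial.continuous_eval q).comp (PiLp.continuous_ofLp 2 _)

theorem isCompact_region (T : Affine.Triangle ℝ Plane) : IsCompact (region T) :=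
  (Set.finite_range T.points).isCompact_convexHull ℝ

theorem memLp_value (T : Affine.Triangle ℝ Plane) (q : Poly) :
    MemLp (value q) 2 (volume.restrict (region T)) := by
  have hK := isCompact_region T
  have : IsFiniteMeasure (volume.restrict (region T)) :=
    ⟨by simpa using hK.measure_lt_top⟩
  obtain ⟨C, hC⟩ := hK.exists_bound_of_continuousOn (continuous_value q).continuousOn
  refine MemLp.of_bound (continuous_value q).aestronglyMeasurable C ?_
  exact ae_restrict_of_forall_mem hK.measurableSet hC

/-- Polynomials as elements of `L²(T)`. -/
def toL2 (T : Affine.Triangle ℝ Plane) : Poly →ₗ[ℝ] Lp ℝ 2 (volume.restrict (region T)) where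
  toFun q := (memLp_value T q).toLp _
  map_add' q r := by
    rw [← MemLp.toLp_add]
    congr 1
    ext x
    simp [value]
  map_smul' c q := by
    rw [RingHom.id_apply, ← MemLp.toLp_const_smul]
    congr 1
    ext x
    simp [value]

theorem inner_toL2 (T : Affine.Triangle ℝ Plane) (q r : Poly) :
    inner ℝ (toL2 T q) (toL2 T r) = ∫ x in region T, value q x * value r x := by
  rw [L2.inner_def]
  refine integral_congr_ae ?_
  filter_upwards [(memLp_value T q).coeFn_toLp, (memLp_value T r).coeFn_toLp] with x hq hr
  change inner ℝ ((memLp_value T q).toLp _ x) ((memLp_value T r).toLp _ x) = _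
  rw [hq, hr]
  simp [mul_comm]

theorem exists_isL2Projection (T : Affine.Triangle ℝ Plane) (n : ℕ) (ξ : Poly) :
    ∃ r, IsL2Projection T n ξ r := by
  let S := (polySpace n).map (toL2 T)
  obtain ⟨r, hr, h⟩ := S.starProjection_apply_mem (toL2 T ξ)
  refine ⟨r, hr, fun q hq => ?_⟩
  rw [← inner_toL2, map_sub, h]
  exact S.starProjection_inner_eq_zero _ _ ⟨q, hq, rfl⟩

theorem eq_zero_of_integral_sq (T : Affine.Triangle ℝ Plane) (q : Poly)
    (h : ∫ x in region T, value q x * value q x = 0) : q = 0 := by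
  have hspan : affineSpan ℝ (Set.range T.points) = ⊤ :=
    T.independent.affineSpan_eq_top_iff_card_eq_finrank_add_one.2 (by simp)
  obtain ⟨c, hc⟩ := interior_convexHull_nonempty_iff_affineSpan_eq_top.2 hspan
  have hint : Integrable (fun x => value q x * value q x) (volume.restrict (region T)) :=
    (memLp_value T q).integrable_mul (memLp_value T q)
  have hae := (integral_eq_zero_iff_of_nonneg (fun x => mul_self_nonneg _) hint).1 h
  have hae' : (fun x => value q x) =ᵐ[volume.restrict (interior (region T))] fun _ => 0 := by
    filter_upwards [ae_restrict_of_ae_restrict_of_subset interior_subset hae] with x hx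
    exact mul_self_eq_zero.1 hx
  have hzero : Set.EqOn (value q) (fun _ => 0) (interior (region T)) :=
    Measure.eqOn_open_of_ae_eq hae' isOpen_interior (continuous_value q).continuousOn
      continuousOn_const
  have han : AnalyticOnNhd ℝ (value q) Set.univ := by
    have h1 := AnalyticOnNhd.eval_mvPolynomial (𝕜 := ℝ) q
    intro x _
    exact (h1 x.ofLp trivial).comp ((PiLp.continuousLinearEquiv 2 ℝ fun _ : Fin 2 => ℝ).analyticAt x)
  have hall : Set.EqOn (value q) 0 Set.univ :=
    han.eqOn_zero_of_preconnected_of_eventuallyEq_zero isPreconnected_univ (Set.mem_univ c)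
      (by filter_upwards [isOpen_interior.mem_nhds hc] with x hx using hzero hx)
  refine MvPolynomial.funext fun y => ?_
  simpa [value] using hall (Set.mem_univ (WithLp.toLp 2 y))

theorem IsL2Projection.unique {T : Affine.Triangle ℝ Plane} {n : ℕ} {ξ r s : Poly}
    (hr : IsL2Projection T n ξ r) (hs : IsL2Projection T n ξ s) : r = s := by
  have hm : r - s ∈ polySpace n := sub_mem hr.mem hs.mem
  have h1 := hr.orthogonal _ hm
  have h2 := hs.orthogonal _ hm
  rw [← inner_toL2] at h1 h2
  refine sub_eq_zero.1 (eq_zero_of_integral_sq T _ ?_)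
  rw [← inner_toL2]
  have h3 : r - s = (ξ - s) - (ξ - r) := by ring
  nth_rewrite 1 [h3]
  rw [map_sub, inner_sub_left, h1, h2, sub_zero]

/-- The `L²(T)`-orthogonal projection onto the polynomials of total degree at most `n`; it is zero
for negative `n`. -/
def l2Projection (T : Affine.Triangle ℝ Plane) : ℤ → Poly → Poly
  | Int.ofNat n, ξ => (exists_isL2Projection T n ξ).choose
  | Int.negSucc _, _ => 0

theorem l2Projection_eq_iff (T : Affine.Triangle ℝ Plane) (n : ℕ) (ξ r : Poly) :
    l2Projection T n ξ = r ↔ IsL2Projection T n ξ r := by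
  have h : IsL2Projection T n ξ (l2Projection T n ξ) := (exists_isL2Projection T n ξ).choose_spec
  exact ⟨fun e => e ▸ h, fun hr => h.unique hr⟩

end InverseTrace

end

/-!
Let `a` be the vertex opposite to the edge `F`. The divergence theorem for the field `q² (x - a)`,
which is tangential on the other two edges, gives `⨍_F q² = ⨍_T q (q + ∂q)`, where `∂` is the
derivative along `x - a`. If `q` has degree at most `k` and is orthogonal to all polynomials of
lower degree, then `∂q ≡ k q` modulo lower degree, so that
`‖q‖²_{L²(F)} = (k + 1) |F| / |T| ‖q‖²_{L²(T)}`. Splitting `θ` into orthogonal layers of degrees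
`k = n + 1, …, p`, the triangle inequality on `F` and the Cauchy-Schwarz inequality give the
constant `∑ (k + 1) = (p - n) (p + n + 3) / 2`.
-/

namespace InverseTrace

section Polynomial

open MvPolynomial

variable {σ R : Type*} [CommRing R]

variable (σ R) in
/-- The polynomials of total degree less than `N`. Unlike `MvPolynomial.restrictTotalDegree` this
includes the zero space, as the case `N = 0`. -/
noncomputable def totalDegreeLT (N : ℕ) : Submodule R (MvPolynomial σ R) :=
  restrictSupport R {e | e.degree < N}

theorem totalDegreeLT_zero : totalDegreeLT σ R 0 = ⊥ := by
  simp [totalDegreeLT, restrictSupport_eq_span]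

theorem totalDegreeLT_succ (N : ℕ) : totalDegreeLT σ R (N + 1) = restrictTotalDegree σ R N := by
  simp only [totalDegreeLT, Nat.lt_succ_iff]
  rfl

theorem monotone_totalDegreeLT : Monotone (totalDegreeLT σ R) :=
  fun _ _ h => restrictSupport_mono R fun _ he => lt_of_lt_of_le he h

instance [Finite σ] : ∀ N, Module.Finite R (totalDegreeLT σ R N)
  | 0 => totalDegreeLT_zero (σ := σ) (R := R) ▸ inferInstance
  | N + 1 => totalDegreeLT_succ (σ := σ) (R := R) N ▸ inferInstance

theorem monomial_mem_totalDegreeLT {e : σ →₀ ℕ} {N : ℕ} (he : e.degree < N) (r : R) :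
    monomial e r ∈ totalDegreeLT σ R N :=
  (monomial_mem_restrictSupport R).2 (.inl he)

/-- The derivative along the radial vector field `x ↦ x - a`. -/
noncomputable def radialDeriv (a : σ → R) : Derivation R (MvPolynomial σ R) (MvPolynomial σ R) :=
  mkDerivation R fun i => X i - C (a i)

theorem radialDeriv_monomial (a : σ → R) (e : σ →₀ ℕ) :
    radialDeriv a (monomial e 1) = e.degree • monomial e 1 -
      ∑ i ∈ e.support, monomial (e - Finsupp.single i 1) ((e i : R) * a i) := by
  have lower_mul_X {i : σ} (hi : i ∈ e.support) :
      monomial (e - Finsupp.single i 1) (e i : R) * X i = e i • monomial e 1 := by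
    have hle : Finsupp.single i 1 ≤ e :=
      Finsupp.single_le_iff.2 (Nat.one_le_iff_ne_zero.2 (Finsupp.mem_support_iff.1 hi))
    rw [X, monomial_mul, tsub_add_cancel_of_le hle, mul_one, ← map_nsmul, nsmul_one]
  rw [radialDeriv, mkDerivation_monomial, one_smul, Finsupp.sum, Finsupp.degree_apply,
    Finset.sum_smul, ← Finset.sum_sub_distrib]
  refine Finset.sum_congr rfl fun i hi => ?_
  rw [smul_eq_mul, mul_sub, lower_mul_X hi, mul_comm _ (C _), C_mul_monomial, mul_comm (a i)]

theorem radialDeriv_sub_smul_mem_totalDegreeLT (a : σ → R) {k : ℕ} {q : MvPolynomial σ R}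
    (hq : q ∈ totalDegreeLT σ R (k + 1)) :
    radialDeriv a q - k • q ∈ totalDegreeLT σ R k := by
  suffices h : totalDegreeLT σ R (k + 1) ≤
      (totalDegreeLT σ R k).comap ((radialDeriv a).toLinearMap - k • LinearMap.id) from h hq
  rw [totalDegreeLT, restrictSupport_eq_span, Submodule.span_le]
  rintro _ ⟨e, he, rfl⟩
  change radialDeriv a (monomial e 1) - k • monomial e 1 ∈ totalDegreeLT σ R k
  rw [radialDeriv_monomial, sub_right_comm]
  refine sub_mem ?_ (Submodule.sum_mem _ fun i hi => monomial_mem_totalDegreeLT ?_ _)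
  · rcases Nat.lt_succ_iff_lt_or_eq.1 he with hlt | heq
    · have hmem := monomial_mem_totalDegreeLT hlt (1 : R)
      exact sub_mem (nsmul_mem hmem _) (nsmul_mem hmem _)
    · simp [heq]
  · have hle : Finsupp.single i 1 ≤ e :=
      Finsupp.single_le_iff.2 (Nat.one_le_iff_ne_zero.2 (Finsupp.mem_support_iff.1 hi))
    have hdegree := congrArg Finsupp.degree (tsub_add_cancel_of_le hle)
    rw [map_add, Finsupp.degree_single] at hdegree
    have : e.degree < k + 1 := he
    lia

/-- The restriction of a polynomial to the line through `a` with direction `w`. -/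
noncomputable def lineRestriction (a w : σ → R) : MvPolynomial σ R →ₐ[R] Polynomial R :=
  aeval fun i => Polynomial.C (a i) + w i • Polynomial.X

theorem lineRestriction_X (a w : σ → R) (i : σ) :
    lineRestriction a w (X i) = Polynomial.C (a i) + w i • Polynomial.X :=
  aeval_X _ i

theorem eval_lineRestriction (a w : σ → R) (q : MvPolynomial σ R) (s : R) :
    (lineRestriction a w q).eval s = eval (a + s • w) q := by
  induction q using MvPolynomial.induction_on with
  | C r => simp
  | add q r hq hr => rw [map_add, Polynomial.eval_add, hq, hr, map_add]
  | mul_X q i hq =>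
    rw [map_mul, Polynomial.eval_mul, hq, map_mul, lineRestriction_X]
    simp [mul_comm s]

theorem lineRestriction_radialDeriv (a w : σ → R) (q : MvPolynomial σ R) :
    lineRestriction a w (radialDeriv a q) =
      Polynomial.X * (lineRestriction a w q).derivative := by
  induction q using MvPolynomial.induction_on with
  | C r => simp
  | add q r hq hr => simp only [map_add, hq, hr, mul_add]
  | mul_X q i hq =>
    have hX : lineRestriction a w (radialDeriv a (X i)) =
        Polynomial.X * (lineRestriction a w (X i)).derivative := by
      simp [lineRestriction_X, radialDeriv, Algebra.mul_smul_comm]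
    rw [Derivation.leibniz, map_add, smul_eq_mul, smul_eq_mul, map_mul, map_mul, hq, hX, map_mul,
      Polynomial.derivative_mul]
    ring

theorem integral_mul_eval_mul_eval_add_X_mul_derivative (r : Polynomial ℝ) :
    ∫ s in (0 : ℝ)..1, s * (r.eval s * (r + Polynomial.X * r.derivative).eval s) =
      r.eval 1 ^ 2 / 2 := by
  have hderiv (s : ℝ) : HasDerivAt (fun s => (s * r.eval s) ^ 2 / 2)
      (s * (r.eval s * (r + Polynomial.X * r.derivative).eval s)) s := by
    refine ((((hasDerivAt_id s).mul (r.hasDerivAt s)).pow 2).div_const 2).congr_deriv ?_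
    simp only [Polynomial.eval_add, Polynomial.eval_mul, Polynomial.eval_X, Pi.mul_apply, id]
    ring
  have hcont : Continuous fun s => s * (r.eval s * (r + Polynomial.X * r.derivative).eval s) := by
    fun_prop
  rw [intervalIntegral.integral_eq_sub_of_hasDerivAt (fun s _ => hderiv s)
    (hcont.intervalIntegrable 0 1)]
  simp

end Polynomial

section Hilbert

open scoped InnerProductSpace

theorem norm_add_sq_le_of_norm_sq_le {G : Type*} [SeminormedAddCommGroup G] {x y : G} {α β A B : ℝ}
    (hα : 0 ≤ α) (hβ : 0 ≤ β) (hA : 0 ≤ A) (hB : 0 ≤ B)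
    (hx : ‖x‖ ^ 2 ≤ α * A) (hy : ‖y‖ ^ 2 ≤ β * B) :
    ‖x + y‖ ^ 2 ≤ (α + β) * (A + B) := by
  have h := Finset.univ.sum_sq_le_sum_mul_sum_of_sq_le_mul (r := ![‖x‖, ‖y‖]) (f := ![α, β])
    (g := ![A, B]) (by simp [hα, hβ]) (by simp [hA, hB]) (by simp [hx, hy])
  calc ‖x + y‖ ^ 2 ≤ (‖x‖ + ‖y‖) ^ 2 := by gcongr; exact norm_add_le x y
    _ ≤ _ := by simpa using h

theorem norm_sq_le_sum_mul_norm_sq_of_mem_orthogonal {V H G : Type*} [AddCommGroup V] [Module ℝ V]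
    [NormedAddCommGroup H] [InnerProductSpace ℝ H] [SeminormedAddCommGroup G] [NormedSpace ℝ G]
    {L : V →ₗ[ℝ] H} {M : V →ₗ[ℝ] G} (hLM : L.ker ≤ M.ker)
    {W : ℕ → Submodule ℝ V} (hW : Monotone W) [∀ k, FiniteDimensional ℝ (W k)]
    {c : ℕ → ℝ} (hc : ∀ k, 0 ≤ c k)
    (hlayer : ∀ k, ∀ v ∈ W (k + 1), L v ∈ ((W k).map L)ᗮ → ‖M v‖ ^ 2 ≤ c k * ‖L v‖ ^ 2)
    {m n : ℕ} (hmn : m ≤ n) {v : V} (hv : v ∈ W n) (hvm : L v ∈ ((W m).map L)ᗮ) :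
    ‖M v‖ ^ 2 ≤ (∑ k ∈ Finset.Ico m n, c k) * ‖L v‖ ^ 2 := by
  induction n, hmn using Nat.le_induction generalizing v with
  | base =>
    have hLv : L v = 0 :=
      inner_self_eq_zero.1 (hvm (L v) (Submodule.mem_map_of_mem hv))
    have hMv : M v = 0 := hLM hLv
    simp [hMv]
  | succ n hmn ih =>
    obtain ⟨_, ⟨u, hu, rfl⟩, z, hz, hvz⟩ := ((W n).map L).exists_add_mem_mem_orthogonal (L v)
    obtain rfl : z = L (v - u) := by rw [map_sub, hvz, add_sub_cancel_left]
    have hum : L u ∈ ((W m).map L)ᗮ := by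
      rw [eq_sub_of_add_eq hvz.symm]
      exact sub_mem hvm (Submodule.orthogonal_le (Submodule.map_mono (hW hmn)) hz)
    have hpythagoras : ‖L v‖ ^ 2 = ‖L u‖ ^ 2 + ‖L (v - u)‖ ^ 2 := by
      rw [hvz, norm_add_sq_real, hz _ (Submodule.mem_map_of_mem hu), mul_zero, add_zero]
    have hlast := hlayer n (v - u) (sub_mem hv (hW n.le_succ hu)) hz
    rw [hpythagoras, Finset.sum_Ico_succ_top hmn, ← add_sub_cancel u v, map_add]
    simpa using norm_add_sq_le_of_norm_sq_le (Finset.sum_nonneg fun k _ => hc k) (hc n)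
      (sq_nonneg _) (sq_nonneg _) (ih hu hum) hlast

theorem norm_sq_toLp {α : Type*} [MeasurableSpace α] {μ : Measure α} {f : α → ℝ}
    (hf : MemLp f 2 μ) : ‖hf.toLp f‖ ^ 2 = ∫ x, f x ^ 2 ∂μ := by
  rw [← real_inner_self_eq_norm_sq, L2.inner_def]
  refine integral_congr_ae ?_
  filter_upwards [hf.coeFn_toLp] with x hx
  rw [hx, real_inner_self_eq_norm_sq, Real.norm_eq_abs, sq_abs]

end Hilbert

section Average

variable {E F G : Type*} [NormedAddCommGroup E] [NormedSpace ℝ E] [MeasurableSpace E]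
  [BorelSpace E] [NormedAddCommGroup F] [NormedSpace ℝ F] [MeasurableSpace F] [BorelSpace F]
  [NormedAddCommGroup G] [NormedSpace ℝ G]

theorem restrict_segment_hausdorffMeasure (b c : E) :
    (μH[1] : Measure E).restrict (segment ℝ b c) =
      nndist b c • (volume.restrict (Set.Icc (0 : ℝ) 1)).map (AffineMap.lineMap b c) := by
  ext s hs
  rw [Measure.restrict_apply hs, Measure.smul_apply, Measure.map_apply (by fun_prop) hs,
    Measure.restrict_apply (hs.preimage (by fun_prop)), segment_eq_image_lineMap,
    ← Set.image_preimage_inter, hausdorffMeasure_lineMap_image, hausdorffMeasure_real]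

theorem setAverage_segment [SecondCountableTopologyEither E G] {b c : E} (hbc : b ≠ c) {f : E → G}
    (hf : Continuous f) :
    ⨍ x in segment ℝ b c, f x ∂μH[1] = ∫ t in (0 : ℝ)..1, f (b + t • (c - b)) := by
  have hdist : (nndist b c : ℝ) ≠ 0 := by simpa using hbc
  rw [setAverage_eq, restrict_segment_hausdorffMeasure, integral_smul_nnreal_measure,
    measureReal_def, hausdorffMeasure_segment, edist_nndist, ENNReal.coe_toReal, NNReal.smul_def,
    inv_smul_smul₀ hdist, integral_map (by fun_prop) hf.aestronglyMeasurable,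
    integral_Icc_eq_integral_Ioc, intervalIntegral.integral_of_le zero_le_one]
  simp only [AffineMap.lineMap_apply_module', add_comm]

theorem isAddHaarMeasure_map_affineEquiv [FiniteDimensional ℝ E] (μ : Measure E)
    [μ.IsAddHaarMeasure] (φ : E ≃ᵃ[ℝ] F) : (μ.map φ).IsAddHaarMeasure := by
  have : FiniteDimensional ℝ F := φ.linear.finiteDimensional
  have hφ : ⇑φ = (· + φ 0) ∘ φ.linear.toContinuousLinearEquiv := by
    ext x
    simpa using φ.map_vadd 0 x
  rw [hφ, ← Measure.map_map (by fun_prop) (by fun_prop)]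
  infer_instance

theorem setAverage_image_affineEquiv [FiniteDimensional ℝ E] (μ : Measure E) [μ.IsAddHaarMeasure]
    (ν : Measure F) [ν.IsAddHaarMeasure] (φ : E ≃ᵃ[ℝ] F) (s : Set E) (f : F → G) :
    ⨍ y in φ '' s, f y ∂ν = ⨍ x in s, f (φ x) ∂μ := by
  have : FiniteDimensional ℝ F := φ.linear.finiteDimensional
  have := isAddHaarMeasure_map_affineEquiv μ φ
  have hφ : MeasurableEmbedding φ :=
    φ.toContinuousAffineEquiv.toHomeomorph.measurableEmbedding
  set κ := ν.addHaarScalarFactor (μ.map φ)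
  have hκ : 0 < κ := Measure.addHaarScalarFactor_pos_of_isAddHaarMeasure _ _
  have hν : ν.restrict (φ '' s) = κ • (μ.restrict s).map φ := by
    rw [Measure.isAddLeftInvariant_eq_smul ν (μ.map φ), Measure.restrict_smul, hφ.restrict_map,
      φ.injective.preimage_image]
  rw [average_eq, average_eq, hν, integral_smul_nnreal_measure, hφ.integral_map,
    measureReal_nnreal_smul_apply, map_measureReal_apply hφ.measurable .univ, Set.preimage_univ,
    NNReal.smul_def, smul_smul, mul_inv_rev, inv_mul_cancel_right₀ (by positivity)]

theorem exists_affineEquiv_of_affineIndependent {V : Type*} [AddCommGroup V] [Module ℝ V]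
    (hV : Module.finrank ℝ V = 2) {P : Fin 3 → V} (hP : AffineIndependent ℝ P) :
    ∃ φ : (ℝ × ℝ) ≃ᵃ[ℝ] V, ∀ z, φ z = P 0 + (z.1 • (P 1 - P 0) + z.2 • (P 2 - P 1)) := by
  have : FiniteDimensional ℝ V := .of_finrank_pos (by simp [hV])
  let L : (ℝ × ℝ) →ₗ[ℝ] V :=
    (LinearMap.fst ℝ ℝ ℝ).smulRight (P 1 - P 0) + (LinearMap.snd ℝ ℝ ℝ).smulRight (P 2 - P 1)
  have hL : Function.Injective L := by
    refine (injective_iff_map_eq_zero L).2 fun z hz => ?_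
    let w : Fin 3 → ℝ := ![-z.1, z.1 - z.2, z.2]
    have hsum : ∑ i, w i = 0 := by
      rw [Fin.sum_univ_three]
      change -z.1 + (z.1 - z.2) + z.2 = 0
      ring
    have hcomb : ∑ i, w i • P i = 0 := by
      rw [← hz, Fin.sum_univ_three]
      change -z.1 • P 0 + (z.1 - z.2) • P 1 + z.2 • P 2 = z.1 • (P 1 - P 0) + z.2 • (P 2 - P 1)
      module
    have hw : ∀ i ∈ Finset.univ, w i = 0 := affineIndependent_iff.1 hP Finset.univ w hsum hcomb
    exact Prod.ext (neg_eq_zero.1 (hw 0 (Finset.mem_univ 0))) (hw 2 (Finset.mem_univ 2))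
  refine ⟨(LinearEquiv.ofInjectiveOfFinrankEq L hL (by simp [hV])).toAffineEquiv.trans
    (AffineEquiv.constVAdd ℝ V (P 0)), fun z => ?_⟩
  change P 0 + L z = _
  simp [L]

/-- The triangle with vertices `(0, 0)`, `(1, 0)` and `(1, 1)`, the image of the unit square under
the map `(s, t) ↦ (s, s * t)` that collapses a side to the first vertex. -/
def unitTriangle : Set (ℝ × ℝ) := {z | 0 ≤ z.2 ∧ z.2 ≤ z.1 ∧ z.1 ≤ 1}

theorem convexHull_eq_unitTriangle :
    convexHull ℝ (Set.range ![((0 : ℝ), (0 : ℝ)), (1, 0), (1, 1)]) = unitTriangle := by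
  refine (convexHull_min ?_ ?_).antisymm fun z hz => ?_
  · rintro _ ⟨i, rfl⟩
    fin_cases i <;> norm_num [unitTriangle]
  · have hsub : IsLinearMap ℝ fun z : ℝ × ℝ => z.1 - z.2 :=
      (LinearMap.fst ℝ ℝ ℝ - LinearMap.snd ℝ ℝ ℝ).isLinear
    have hconvex := (convex_halfSpace_ge (LinearMap.snd ℝ ℝ ℝ).isLinear 0).inter
      ((convex_halfSpace_ge hsub 0).inter (convex_halfSpace_le (LinearMap.fst ℝ ℝ ℝ).isLinear 1))
    convert hconvex using 1
    ext z
    simp [unitTriangle]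
  · obtain ⟨h0, h1, h2⟩ := hz
    have hcomb := (convex_convexHull ℝ (Set.range ![((0 : ℝ), (0 : ℝ)), (1, 0), (1, 1)])).sum_mem
      (t := Finset.univ) (w := ![1 - z.1, z.1 - z.2, z.2])
      (by simp [Fin.forall_fin_succ, h0, h1, h2]) (by simp [Fin.sum_univ_three])
      fun i _ => subset_convexHull ℝ _ (Set.mem_range_self i)
    convert hcomb using 1
    ext <;> simp [Fin.sum_univ_three]

theorem isCompact_unitTriangle : IsCompact unitTriangle :=
  convexHull_eq_unitTriangle ▸ (Set.finite_range _).isCompact_convexHull ℝ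

theorem integral_unitTriangle {f : ℝ × ℝ → G} (hf : IntegrableOn f unitTriangle) :
    ∫ z in unitTriangle, f z = ∫ s in (0 : ℝ)..1, ∫ t in (0 : ℝ)..1, s • f (s, s * t) := by
  have hm := isCompact_unitTriangle.measurableSet
  have hslice (s y : ℝ) : unitTriangle.indicator f (s, y) = (Set.Icc 0 1).indicator
      (fun s => (Set.Icc 0 s).indicator (fun y => f (s, y)) y) s := by
    simp only [Set.indicator, unitTriangle, Set.mem_ofPred_eq, Set.mem_Icc, ← ite_and]
    congr 1
    grind
  have hinner (s : ℝ) : ∫ y, unitTriangle.indicator f (s, y) =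
      (Set.Icc 0 1).indicator (fun s => ∫ t in (0 : ℝ)..1, s • f (s, s * t)) s := by
    by_cases hs : s ∈ Set.Icc (0 : ℝ) 1
    · simp only [hslice, Set.indicator_of_mem hs]
      rw [integral_indicator measurableSet_Icc, integral_Icc_eq_integral_Ioc,
        ← intervalIntegral.integral_of_le hs.1, intervalIntegral.integral_smul,
        intervalIntegral.smul_integral_comp_mul_left (f := fun y => f (s, y)), mul_zero, mul_one]
    · simp only [hslice, Set.indicator_of_notMem hs, integral_zero]
  rw [← integral_indicator hm, Measure.volume_eq_prod,
    integral_prod _ ((integrable_indicator_iff hm).2 hf)]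
  simp only [hinner]
  rw [integral_indicator measurableSet_Icc, integral_Icc_eq_integral_Ioc,
    intervalIntegral.integral_of_le zero_le_one]

theorem volume_real_unitTriangle : volume.real unitTriangle = 1 / 2 := by
  have h := integral_unitTriangle (f := fun _ => (1 : ℝ))
    (integrableOn_const isCompact_unitTriangle.measure_ne_top)
  simpa using h

theorem setAverage_convexHull_triangle (hE : Module.finrank ℝ E = 2) (μ : Measure E)
    [μ.IsAddHaarMeasure] {P : Fin 3 → E} (hP : AffineIndependent ℝ P) {f : E → G}
    (hf : Continuous f) :
    ⨍ x in convexHull ℝ (Set.range P), f x ∂μ = (2 : ℝ) • ∫ t in (0 : ℝ)..1, ∫ s in (0 : ℝ)..1,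
      s • f (P 0 + s • (P 1 - P 0 + t • (P 2 - P 1))) := by
  obtain ⟨φ, hφ⟩ := exists_affineEquiv_of_affineIndependent hE hP
  have hvertices : φ ∘ ![(0, 0), (1, 0), (1, 1)] = P := by
    ext i
    fin_cases i <;> simp [hφ]
  have hconvexHull : convexHull ℝ (Set.range P) = φ '' unitTriangle := by
    rw [← convexHull_eq_unitTriangle, ← φ.coe_toAffineMap, AffineMap.image_convexHull,
      ← Set.range_comp, φ.coe_toAffineMap, hvertices]
  have hφ_cont : Continuous φ := by
    simp only [funext hφ]
    fun_prop
  have hcont : Continuous (Function.uncurry fun s t : ℝ => s • f (φ (s, s * t))) := by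
    unfold Function.uncurry
    fun_prop
  rw [hconvexHull, setAverage_image_affineEquiv volume, setAverage_eq, volume_real_unitTriangle,
    integral_unitTriangle (f := fun z => f (φ z))
      ((hf.comp hφ_cont).continuousOn.integrableOn_compact isCompact_unitTriangle),
    intervalIntegral_intervalIntegral_swap]
  · simp [hφ, smul_add, smul_smul]
  · exact (hcont.continuousOn.integrableOn_compact (isCompact_uIcc.prod isCompact_uIcc)).mono_set
      (Set.prod_mono Set.uIoc_subset_uIcc Set.uIoc_subset_uIcc)

end Average

theorem sum_Ico_natCast_add_one {K : Type*} [Field K] [CharZero K] {m n : ℕ} (hmn : m ≤ n) :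
    ∑ k ∈ Finset.Ico m n, ((k : K) + 1) = (n - m) * (n + m + 1) / 2 := by
  induction n, hmn using Nat.le_induction with
  | base => simp
  | succ n hmn ih =>
    rw [Finset.sum_Ico_succ_top hmn, ih]
    push_cast
    ring

section Triangle

theorem measure_edge_ne_top (T : Affine.Triangle ℝ Plane) (i j : Fin 3) :
    lengthMeasure (edge T i j) ≠ ⊤ := by
  rw [lengthMeasure, edge, hausdorffMeasure_segment]
  exact edist_ne_top _ _

theorem memLp_edge_value (T : Affine.Triangle ℝ Plane) (i j : Fin 3) (q : Poly) :
    MemLp (value q) 2 (lengthMeasure.restrict (edge T i j)) := by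
  have : IsFiniteMeasure (lengthMeasure.restrict (edge T i j)) :=
    ⟨by simpa using (measure_edge_ne_top T i j).lt_top⟩
  have hK : IsCompact (edge T i j) := by
    rw [edge, segment_eq_image_lineMap]
    exact isCompact_Icc.image AffineMap.lineMap_continuous
  obtain ⟨C, hC⟩ := hK.exists_bound_of_continuousOn (continuous_value q).continuousOn
  exact .of_bound (continuous_value q).aestronglyMeasurable C
    (ae_restrict_of_forall_mem hK.measurableSet hC)

/-- The trace of polynomials on an edge, as elements of `L²` for the arc length measure. -/
noncomputable def edgeL2 (T : Affine.Triangle ℝ Plane) (i j : Fin 3) :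
    Poly →ₗ[ℝ] Lp ℝ 2 (lengthMeasure.restrict (edge T i j)) where
  toFun q := (memLp_edge_value T i j q).toLp _
  map_add' q r := by
    rw [← MemLp.toLp_add]
    congr 1
    ext x
    simp [value]
  map_smul' c q := by
    rw [RingHom.id_apply, ← MemLp.toLp_const_smul]
    congr 1
    ext x
    simp [value]

variable (T : Affine.Triangle ℝ Plane)

theorem norm_sq_toL2 (q : Poly) : ‖toL2 T q‖ ^ 2 = normSqTriangle T q :=
  norm_sq_toLp (memLp_value T q)

theorem norm_sq_edgeL2 (i j : Fin 3) (q : Poly) : ‖edgeL2 T i j q‖ ^ 2 = normSqEdge T i j q :=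
  norm_sq_toLp (memLp_edge_value T i j q)

theorem ker_toL2 : (toL2 T).ker = ⊥ :=
  LinearMap.ker_eq_bot'.2 fun q hq => eq_zero_of_integral_sq T q <| by
    rw [← inner_toL2, hq, inner_zero_left]

theorem integral_value_mul_value_radial (a w : Plane) (q : Poly) :
    ∫ s in (0 : ℝ)..1, s * (value q (a + s • w) *
      value (q + radialDeriv a.ofLp q) (a + s • w)) = value q (a + w) ^ 2 / 2 := by
  have hline (r : Poly) (s : ℝ) :
      value r (a + s • w) = (lineRestriction a.ofLp w.ofLp r).eval s :=
    (eval_lineRestriction ..).symm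
  simp only [hline, map_add, lineRestriction_radialDeriv]
  rw [integral_mul_eval_mul_eval_add_X_mul_derivative, ← hline, one_smul]

theorem setAverage_edge_value_sq (e : Equiv.Perm (Fin 3)) (q : Poly) :
    ⨍ x in edge T (e 1) (e 2), value q x ^ 2 ∂lengthMeasure =
      ⨍ x in region T, value q x * value (q + radialDeriv (T.points (e 0)).ofLp q) x := by
  have hP : AffineIndependent ℝ (T.points ∘ e) := T.independent.comp_embedding e.toEmbedding
  rw [edge, lengthMeasure, setAverage_segment (T.independent.injective.ne (by simp))
      ((continuous_value q).fun_pow 2), region, ← e.surjective.range_comp T.points,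
    setAverage_convexHull_triangle (by simp) volume hP
      ((continuous_value q).fun_mul (continuous_value _))]
  simp only [Function.comp_apply, smul_eq_mul, integral_value_mul_value_radial,
    intervalIntegral.integral_div, mul_div_cancel₀ _ (two_ne_zero' ℝ), ← add_assoc,
    add_sub_cancel]

theorem l2Projection_natCast_sub_one_mem (m : ℕ) (ξ : Poly) :
    l2Projection T (m - 1) ξ ∈ totalDegreeLT (Fin 2) ℝ m := by
  cases m with
  | zero => exact zero_mem _
  | succ m =>
    rw [totalDegreeLT_succ, Nat.cast_succ, add_sub_cancel_right]
    exact ((l2Projection_eq_iff T m ξ _).1 rfl).mem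

theorem toL2_sub_l2Projection_mem_orthogonal (m : ℕ) (ξ : Poly) :
    toL2 T (ξ - l2Projection T (m - 1) ξ) ∈ ((totalDegreeLT (Fin 2) ℝ m).map (toL2 T))ᗮ := by
  cases m with
  | zero => simp [totalDegreeLT_zero]
  | succ m =>
    rw [totalDegreeLT_succ, Nat.cast_succ, add_sub_cancel_right, Submodule.mem_orthogonal']
    rintro _ ⟨q, hq, rfl⟩
    rw [inner_toL2]
    exact ((l2Projection_eq_iff T m ξ _).1 rfl).orthogonal q hq

variable {T}

theorem normSqEdge_eq_of_mem_orthogonal {i j : Fin 3} (hij : i ≠ j) {k : ℕ} {q : Poly}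
    (hq : q ∈ totalDegreeLT (Fin 2) ℝ (k + 1))
    (horth : toL2 T q ∈ ((totalDegreeLT (Fin 2) ℝ k).map (toL2 T))ᗮ) :
    normSqEdge T i j q =
      (k + 1) * (lengthMeasure.real (edge T i j) / volume.real (region T)) *
        normSqTriangle T q := by
  obtain ⟨e, rfl, rfl⟩ : ∃ e : Equiv.Perm (Fin 3), e 1 = i ∧ e 2 = j := by
    revert i j
    decide
  have hradial : ∫ x in region T, value q x * value (q + radialDeriv (T.points (e 0)).ofLp q) x =
      (k + 1) * normSqTriangle T q := by
    have hlower := horth _ (Submodule.mem_map_of_mem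
      (radialDeriv_sub_smul_mem_totalDegreeLT (T.points (e 0)).ofLp hq))
    rw [real_inner_comm, map_sub, map_nsmul, inner_sub_right, sub_eq_zero] at hlower
    rw [← inner_toL2, map_add, inner_add_right, hlower, ← Nat.cast_smul_eq_nsmul ℝ,
      real_inner_smul_right, real_inner_self_eq_norm_sq, norm_sq_toL2]
    ring
  rw [normSqEdge, ← measure_smul_setAverage _ (measure_edge_ne_top T _ _), setAverage_edge_value_sq,
    setAverage_eq, hradial, smul_eq_mul, smul_eq_mul]
  ring

theorem normSqEdge_le_of_mem_orthogonal {i j : Fin 3} (hij : i ≠ j) {m n : ℕ} (hmn : m ≤ n)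
    {θ : Poly} (hθ : θ ∈ totalDegreeLT (Fin 2) ℝ n)
    (horth : toL2 T θ ∈ ((totalDegreeLT (Fin 2) ℝ m).map (toL2 T))ᗮ) :
    normSqEdge T i j θ ≤ ((n : ℝ) - m) * (n + m + 1) / 2 *
      (lengthMeasure.real (edge T i j) / volume.real (region T)) * normSqTriangle T θ := by
  rw [← sum_Ico_natCast_add_one hmn, Finset.sum_mul, ← norm_sq_edgeL2, ← norm_sq_toL2]
  refine norm_sq_le_sum_mul_norm_sq_of_mem_orthogonal (by simp [ker_toL2]) monotone_totalDegreeLT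
    (fun k => by positivity) (fun k q hq hqorth => ?_) hmn hθ horth
  rw [norm_sq_edgeL2, norm_sq_toL2]
  exact (normSqEdge_eq_of_mem_orthogonal hij hq hqorth).le

end Triangle

end InverseTrace

theorem mainTheorem3 (T : Affine.Triangle ℝ InverseTrace.Plane) (i j : Fin 3) (hij : i ≠ j)
    (p : ℕ) (n : ℤ) (hn : -1 ≤ n) (hnp : n ≤ p)
    (ξ : InverseTrace.Poly) (hξ : ξ ∈ InverseTrace.polySpace p) :
    InverseTrace.normSqEdge T i j (ξ - InverseTrace.l2Projection T n ξ) ≤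
      ((p : ℝ) - n) * ((p : ℝ) + n + 3) / 2 *
        (InverseTrace.lengthMeasure.real (InverseTrace.edge T i j) /
          (MeasureTheory.volume : MeasureTheory.Measure InverseTrace.Plane).real
            (InverseTrace.region T)) *
        InverseTrace.normSqTriangle T (ξ - InverseTrace.l2Projection T n ξ) := by
  open InverseTrace in
  obtain ⟨m, rfl⟩ : ∃ m : ℕ, n = m - 1 := ⟨(n + 1).toNat, by lia⟩
  have hmp : m ≤ p + 1 := by lia
  have hθ : ξ - l2Projection T (m - 1) ξ ∈ totalDegreeLT (Fin 2) ℝ (p + 1) :=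
    sub_mem (totalDegreeLT_succ (R := ℝ) p ▸ hξ)
      (monotone_totalDegreeLT hmp (l2Projection_natCast_sub_one_mem T m ξ))
  refine (normSqEdge_le_of_mem_orthogonal hij hmp hθ
    (toL2_sub_l2Projection_mem_orthogonal T m ξ)).trans_eq ?_
  push_cast
  ring
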